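/- Let $V_0$ be the access structure on the set of parties $\{1,\dots,7\}$ (a port of the Vámos matroid) whose minimal qualified sets are $\{1,2,3\}$, $\{1,4,5\}$ and all $4$-element subsets of $\{1,\dots,7\}$ that contain neither of these two sets and are different from $\{2,3,4,5\}$, $\{2,3,6,7\}$ and $\{4,5,6,7\}$. Let $S_0,S_1,\dots,S_7$ be jointly distributed finite-valued random variables ($S_0$ is the secret, $S_1,\dots,S_7$ are the shares), let $H$ denote Shannon entropy, $S_V=(S_i)_{i\in V}$ and $H(S_0\mid S_V)=H(S_0,S_V)-H(S_V)$. Suppose that $H(S_0)>0$ and that $(S_0,\dots,S_7)$ is a perfect secret sharing scheme for $V_0$, that is, (i) $H(S_0\mid S_V)=0$ for every minimal qualified set $V$; (ii) $H(S_0\mid S_V)=H(S_0)$ for every $V\subseteq\{1,\dots,7\}$ that includes no minimal qualified set. Then the information ratio of the scheme satisfies $$\frac{\max\{H(S_1),\dots,H(S_7)\}}{H(S_0)}\ \ge\ \frac{561}{491}=1.142566\ldots$$ Equivalently, the optimal information ratio (the infimum of this ratio over all such schemes) is at least $561/491$. -/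

import Mathlib

open MeasureTheory

noncomputable section

namespace SecretSharing

/-- Shannon entropy of a finite-valued random variable `X` on the probability space `(Ω, μ)`, in
nats. The base of the logarithm cancels in every ratio of entropies. -/
def entropy {Ω : Type*} [MeasurableSpace Ω] (μ : Measure Ω) {β : Type*} [Fintype β]
    (X : Ω → β) : ℝ :=
  ∑ b, Real.negMulLog (μ.real (X ⁻¹' {b}))

/-- The tuple `S_V = (S_i)_{i ∈ V}` as one random variable. -/
def tuple {Ω ι : Type*} {α : ι → Type*} (S : (i : ι) → Ω → α i) (V : Finset ι) :
    Ω → ((i : V) → α i) :=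
  fun ω i => S i ω

/-- `H(S_U | S_V) = H(S_{U ∪ V}) - H(S_V)`. -/
def condEntropy {Ω : Type*} [MeasurableSpace Ω] (μ : Measure Ω) {ι : Type*} [DecidableEq ι]
    {α : ι → Type*} [∀ i, Fintype (α i)] (S : (i : ι) → Ω → α i) (U V : Finset ι) : ℝ :=
  entropy μ (tuple S (U ∪ V)) - entropy μ (tuple S V)

/-- A family `(S_0, …, S_n)` is a perfect secret sharing scheme with secret `S_0` and shares
`S_1, …, S_n`, for the access structure on the parties `{1, …, n}` whose minimal qualified sets are
the members of `M`. -/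
structure IsPerfectScheme {Ω : Type*} [MeasurableSpace Ω] (μ : Measure Ω) {n : ℕ}
    {α : Fin (n + 1) → Type*} [∀ i, Fintype (α i)] (S : (i : Fin (n + 1)) → Ω → α i)
    (M : Set (Finset (Fin (n + 1)))) : Prop where
  correct : ∀ V ∈ M, condEntropy μ S {0} V = 0
  priv : ∀ V : Finset (Fin (n + 1)), 0 ∉ V → (∀ Q ∈ M, ¬ Q ⊆ V) →
    condEntropy μ S {0} V = entropy μ (S 0)

/-- The information ratio `max {H(S_1), …, H(S_n)} / H(S_0)` of a scheme with `n + 1 ≥ 1`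
parties. -/
def informationRatio {Ω : Type*} [MeasurableSpace Ω] (μ : Measure Ω) {n : ℕ}
    {α : Fin (n + 2) → Type*} [∀ i, Fintype (α i)] (S : (i : Fin (n + 2)) → Ω → α i) : ℝ :=
  (Finset.univ.sup' Finset.univ_nonempty
    fun i : Fin (n + 1) => entropy μ (S i.succ)) / entropy μ (S 0)

/-- The minimal qualified sets of the access structure `V_0` on the Vámos matroid, with parties
`{1, …, 7}`. -/
def vamosMinimalQualified : Set (Finset (Fin 8)) :=
  {V | V = {1, 2, 3} ∨ V = {1, 4, 5} ∨
    (0 ∉ V ∧ V.card = 4 ∧ ¬ {1, 2, 3} ⊆ V ∧ ¬ {1, 4, 5} ⊆ V ∧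
      V ≠ {2, 3, 4, 5} ∧ V ≠ {2, 3, 6, 7} ∧ V ≠ {4, 5, 6, 7})}

end SecretSharing

end

/-! Joint entropies of actual random variables obey more than monotonicity and submodularity. By the
copy lemma (`isCopy_copyFamily`), variables can be duplicated so that the copies have the same joint
law with a chosen set b as the originals and are independent of all originals given b. Shannon
inequalities for the enlarged family then constrain the original one.

Two copy steps are chained. The copies inherit qualified sets: for instance, a copy of share 1 over
2, 3, 4, 5 recovers the copied secret both with 2, 3 and with 4, 5. Together with correctness and
privacy, a linear programming certificate (`eight_mul_secret_le`) yields 48 H(S_0) ≤ 28 H(S_1) + 2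
H(S_2) + 4 (H(S_3) + H(S_4) + H(S_5)), so the ratio is at least 8/7, slightly more than 561/491.

Random variables are treated as partitions of a finite weighted set, so that joint variables are
meets and the copy lemma is an explicit coupling on pairs of outcomes. Submodularity
(`partitionEntropy_submodular`) comes from log t ≤ t - 1. -/

open Classical in
/-- The probability of the class of `ω` in the partition `r`. -/
noncomputable def classMass {Ω : Type*} [Fintype Ω] (p : Ω → ℝ) (r : Setoid Ω) (ω : Ω) : ℝ :=
  ∑ x, if r ω x then p x else 0

/-- The Shannon entropy of a partition of a finite set of outcomes with weights `p`. -/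
noncomputable def partitionEntropy {Ω : Type*} [Fintype Ω] (p : Ω → ℝ) (r : Setoid Ω) : ℝ :=
  -∑ ω, p ω * Real.log (classMass p r ω)

/-! ### Shannon inequalities for partitions -/

section PartitionEntropy

variable {Ω : Type*} [Fintype Ω] {p : Ω → ℝ} {r s : Setoid Ω}

theorem classMass_congr {x y : Ω} (h : r x y) : classMass p r x = classMass p r y := by
  unfold classMass
  refine Finset.sum_congr rfl fun z _ => ?_
  have : r x z ↔ r y z := ⟨fun hz => r.trans (r.symm h) hz, fun hz => r.trans h hz⟩
  by_cases hz : r x z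
  · rw [if_pos hz, if_pos (this.1 hz)]
  · rw [if_neg hz, if_neg fun h' => hz (this.2 h')]

theorem classMass_nonneg (hp : ∀ ω, 0 ≤ p ω) (r : Setoid Ω) (ω : Ω) : 0 ≤ classMass p r ω :=
  Finset.sum_nonneg fun x _ => by split_ifs <;> simp [hp]

theorem le_classMass (hp : ∀ ω, 0 ≤ p ω) (r : Setoid Ω) (ω : Ω) : p ω ≤ classMass p r ω := by
  classical
  have := Finset.single_le_sum (f := fun x => if r ω x then p x else 0)
    (fun x _ => by split_ifs <;> simp [hp]) (Finset.mem_univ ω)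
  simpa [classMass, r.refl ω] using this

/-- Logarithms and quotients matter only at outcomes of nonzero weight; this makes them legitimate
there. -/
theorem classMass_pos (hp : ∀ ω, 0 ≤ p ω) (r : Setoid Ω) {ω : Ω} (h : p ω ≠ 0) :
    0 < classMass p r ω :=
  ((hp ω).lt_of_ne' h).trans_le (le_classMass hp r ω)

theorem classMass_anti (hp : ∀ ω, 0 ≤ p ω) (h : r ≤ s) (ω : Ω) :
    classMass p r ω ≤ classMass p s ω := by
  refine Finset.sum_le_sum fun x _ => ?_
  by_cases hr : r ω x
  · simp [hr, h hr]
  · simp only [hr, if_false]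
    split_ifs <;> simp [hp]

/-- Finer partitions have larger entropy. -/
theorem partitionEntropy_anti (hp : ∀ ω, 0 ≤ p ω) (h : r ≤ s) :
    partitionEntropy p s ≤ partitionEntropy p r := by
  refine neg_le_neg (Finset.sum_le_sum fun ω _ => ?_)
  by_cases h0 : p ω = 0
  · simp [h0]
  · exact mul_le_mul_of_nonneg_left
      (Real.log_le_log (classMass_pos hp r h0) (classMass_anti hp h ω)) (hp ω)

/-- Summing the conditional weights over the class of `ω` gives one, unless the class is null. -/
theorem sum_div_classMass (r : Setoid Ω) (ω : Ω) [DecidablePred (r ω)] :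
    ∑ x, (if r ω x then p x / classMass p r x else 0) = if classMass p r ω = 0 then 0 else 1 := by
  have : ∀ x, (if r ω x then p x / classMass p r x else 0) =
      (if r ω x then p x else 0) / classMass p r ω := fun x => by
    split_ifs with hx
    · rw [classMass_congr hx]
    · simp
  rw [Finset.sum_congr rfl fun x _ => this x, ← Finset.sum_div]
  have h2 : ∑ x, (if r ω x then p x else 0) = classMass p r ω := by
    unfold classMass; congr!
  rw [h2]
  split_ifs with h
  · simp [h]
  · exact div_self h

theorem mul_classMass_div (hp : ∀ ω, 0 ≤ p ω) (r : Setoid Ω) (ω : Ω) :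
    p ω / classMass p r ω * classMass p r ω = p ω := by
  by_cases h : p ω = 0
  · simp [h]
  · exact div_mul_cancel₀ _ (classMass_pos hp r h).ne'

/-- Auxiliary bound for submodularity: the total mass of the conditionally independent coupling,
spread over the common refinement. -/
theorem sum_mul_classMass_div_le (hp : ∀ ω, 0 ≤ p ω) {u v k : Setoid Ω} (hu : u ≤ k) (hv : v ≤ k) :
    ∑ ω, p ω / classMass p (u ⊓ v) ω * (classMass p u ω * classMass p v ω / classMass p k ω)
      ≤ ∑ ω, p ω := by
  classical
  -- The outcomes ω that meet both conditions are either absent or form one class of `u ⊓ v`, inside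
  -- the `k`-class of x and y. Their conditional weights sum to 1, or to 0 if the class is null.
  have key : ∀ x y,
      ∑ ω, (if u ω x ∧ v ω y then p ω / classMass p (u ⊓ v) ω / classMass p k ω else 0) ≤
        if k x y then 1 / classMass p k x else 0 := by
    intro x y
    by_cases hex : ∃ ω, u ω x ∧ v ω y
    · obtain ⟨z, hzx, hzy⟩ := hex
      have hk : k x y := k.trans (k.symm (hu hzx)) (hv hzy)
      have : ∀ ω, (if u ω x ∧ v ω y then p ω / classMass p (u ⊓ v) ω / classMass p k ω else 0) =
          (if (u ⊓ v) z ω then p ω / classMass p (u ⊓ v) ω else 0) / classMass p k x := by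
        intro ω
        have hiff : (u ω x ∧ v ω y) ↔ (u ⊓ v) z ω := by
          change _ ↔ u z ω ∧ v z ω
          exact ⟨fun h => ⟨u.trans hzx (u.symm h.1), v.trans hzy (v.symm h.2)⟩,
            fun h => ⟨u.trans (u.symm h.1) hzx, v.trans (v.symm h.2) hzy⟩⟩
        by_cases h : u ω x ∧ v ω y
        · rw [if_pos h, if_pos (hiff.1 h), classMass_congr (hu h.1)]
        · rw [if_neg h, if_neg (fun h' => h (hiff.2 h')), zero_div]
      rw [Finset.sum_congr rfl fun ω _ => this ω, ← Finset.sum_div, sum_div_classMass, if_pos hk]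
      gcongr
      · exact classMass_nonneg hp k x
      · split_ifs <;> norm_num
    · push Not at hex
      rw [Finset.sum_eq_zero fun ω _ => if_neg fun h => hex ω h.1 h.2]
      split_ifs
      · exact one_div_nonneg.2 (classMass_nonneg hp k x)
      · rfl
  calc ∑ ω, p ω / classMass p (u ⊓ v) ω * (classMass p u ω * classMass p v ω / classMass p k ω)
      = ∑ ω, ∑ x, ∑ y, p x * p y *
          (if u ω x ∧ v ω y then p ω / classMass p (u ⊓ v) ω / classMass p k ω else 0) := by
        refine Finset.sum_congr rfl fun ω _ => ?_
        have : classMass p u ω * classMass p v ω =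
            ∑ x, ∑ y, (if u ω x then p x else 0) * (if v ω y then p y else 0) := by
          rw [classMass, classMass, Finset.sum_mul_sum]
        rw [mul_div_assoc', mul_comm (p ω / _), mul_div_assoc, this, Finset.sum_mul]
        refine Finset.sum_congr rfl fun x _ => ?_
        rw [Finset.sum_mul]
        refine Finset.sum_congr rfl fun y _ => ?_
        by_cases h1 : u ω x <;> by_cases h2 : v ω y <;> simp [h1, h2]
    _ = ∑ x, ∑ y, p x * p y *
          ∑ ω, (if u ω x ∧ v ω y then p ω / classMass p (u ⊓ v) ω / classMass p k ω else 0) := by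
        rw [Finset.sum_comm]
        refine Finset.sum_congr rfl fun x _ => ?_
        rw [Finset.sum_comm]
        exact Finset.sum_congr rfl fun y _ => (Finset.mul_sum _ _ _).symm
    _ ≤ ∑ x, ∑ y, p x * p y * (if k x y then 1 / classMass p k x else 0) :=
        Finset.sum_le_sum fun x _ => Finset.sum_le_sum fun y _ =>
          mul_le_mul_of_nonneg_left (key x y) (mul_nonneg (hp x) (hp y))
    _ = ∑ x, p x := by
        refine Finset.sum_congr rfl fun x _ => ?_
        have : ∀ y, p x * p y * (if k x y then 1 / classMass p k x else 0) =
            p x / classMass p k x * (if k x y then p y else 0) := fun y => by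
          split_ifs <;> ring
        rw [Finset.sum_congr rfl fun y _ => this y, ← Finset.mul_sum]
        exact mul_classMass_div hp k x

/-- Submodularity of entropy: `u` and `v` refine `k`. -/
theorem partitionEntropy_submodular (hp : ∀ ω, 0 ≤ p ω) {u v k : Setoid Ω}
    (hu : u ≤ k) (hv : v ≤ k) :
    partitionEntropy p (u ⊓ v) + partitionEntropy p k
      ≤ partitionEntropy p u + partitionEntropy p v := by
  -- This is log t ≤ t - 1 for t = P(u) P(v) / (P(u ⊓ v) P(k)), weighted by `p ω`.
  have key : ∀ ω, p ω * Real.log (classMass p u ω) + p ω * Real.log (classMass p v ω)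
      - p ω * Real.log (classMass p (u ⊓ v) ω) - p ω * Real.log (classMass p k ω) ≤
      p ω / classMass p (u ⊓ v) ω * (classMass p u ω * classMass p v ω / classMass p k ω)
        - p ω := by
    intro ω
    by_cases h0 : p ω = 0
    · simp [h0]
    have h1 := classMass_pos hp u h0
    have h2 := classMass_pos hp v h0
    have h3 := classMass_pos hp (u ⊓ v) h0
    have h4 := classMass_pos hp k h0
    have := Real.log_le_sub_one_of_pos (x := classMass p u ω * classMass p v ω /
      (classMass p (u ⊓ v) ω * classMass p k ω)) (by positivity)
    rw [Real.log_div (by positivity) (by positivity), Real.log_mul h1.ne' h2.ne',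
      Real.log_mul h3.ne' h4.ne'] at this
    have := mul_le_mul_of_nonneg_left this (hp ω)
    calc _ = p ω * (Real.log (classMass p u ω) + Real.log (classMass p v ω) -
          (Real.log (classMass p (u ⊓ v) ω) + Real.log (classMass p k ω))) := by ring
      _ ≤ _ := this
      _ = _ := by field_simp
  have := Finset.sum_le_sum fun ω (_ : ω ∈ Finset.univ) => key ω
  have h2 := sum_mul_classMass_div_le hp hu hv
  simp only [Finset.sum_sub_distrib, Finset.sum_add_distrib] at this
  unfold partitionEntropy
  linarith

end PartitionEntropy

/-! ### The conditionally independent coupling -/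

open Classical in
/-- Two copies of the outcome, with the same class in the partition `k` and conditionally
independent given that class. -/
noncomputable def copyWeight {Ω : Type*} [Fintype Ω] (p : Ω → ℝ) (k : Setoid Ω) (z : Ω × Ω) : ℝ :=
  if k z.1 z.2 then p z.1 * p z.2 / classMass p k z.1 else 0

section Copy

variable {Ω : Type*} [Fintype Ω] {p : Ω → ℝ} {k : Setoid Ω}

theorem copyWeight_nonneg (hp : ∀ ω, 0 ≤ p ω) (k : Setoid Ω) (z : Ω × Ω) :
    0 ≤ copyWeight p k z := by
  unfold copyWeight
  split_ifs
  · exact div_nonneg (mul_nonneg (hp _) (hp _)) (classMass_nonneg hp k _)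
  · rfl

theorem copyWeight_swap (p : Ω → ℝ) (k : Setoid Ω) (x y : Ω) :
    copyWeight p k (x, y) = copyWeight p k (y, x) := by
  by_cases h : k x y
  · simp only [copyWeight, h, k.symm h, if_true, classMass_congr h, mul_comm]
  · have h' : ¬ k y x := fun h' => h (k.symm h')
    simp only [copyWeight, h, h', if_false]

theorem sum_copyWeight_left (hp : ∀ ω, 0 ≤ p ω) (k : Setoid Ω) (x : Ω) :
    ∑ y, copyWeight p k (x, y) = p x := by
  classical
  have : ∀ y, copyWeight p k (x, y) = p x / classMass p k x * (if k x y then p y else 0) := by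
    intro y
    by_cases h : k x y
    · simp only [copyWeight, h, if_true]; ring
    · simp only [copyWeight, h, if_false, mul_zero]
  rw [Finset.sum_congr rfl fun y _ => this y, ← Finset.mul_sum]
  exact mul_classMass_div hp k x

theorem sum_copyWeight_right (hp : ∀ ω, 0 ≤ p ω) (k : Setoid Ω) (y : Ω) :
    ∑ x, copyWeight p k (x, y) = p y := by
  simp only [fun x => copyWeight_swap p k x y, sum_copyWeight_left hp k y]

theorem sum_copyWeight_mul_fst (hp : ∀ ω, 0 ≤ p ω) (k : Setoid Ω) (f : Ω → ℝ) :
    ∑ z : Ω × Ω, copyWeight p k z * f z.1 = ∑ x, p x * f x := by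
  rw [Fintype.sum_prod_type]
  exact Finset.sum_congr rfl fun x _ => by
    dsimp only
    rw [← Finset.sum_mul, sum_copyWeight_left hp]

theorem sum_copyWeight_mul_snd (hp : ∀ ω, 0 ≤ p ω) (k : Setoid Ω) (f : Ω → ℝ) :
    ∑ z : Ω × Ω, copyWeight p k z * f z.2 = ∑ x, p x * f x := by
  rw [Fintype.sum_prod_type_right]
  exact Finset.sum_congr rfl fun x _ => by
    dsimp only
    rw [← Finset.sum_mul, sum_copyWeight_right hp]

theorem rel_of_copyWeight_ne_zero {z : Ω × Ω} (h : copyWeight p k z ≠ 0) : k z.1 z.2 := by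
  by_contra h'
  exact h (by simp only [copyWeight, h', if_false])

theorem left_ne_zero_of_copyWeight_ne_zero {z : Ω × Ω} (h : copyWeight p k z ≠ 0) : p z.1 ≠ 0 := by
  intro h'
  apply h
  unfold copyWeight
  split_ifs <;> simp [h']

theorem right_ne_zero_of_copyWeight_ne_zero {z : Ω × Ω} (h : copyWeight p k z ≠ 0) :
    p z.2 ≠ 0 := by
  intro h'
  apply h
  unfold copyWeight
  split_ifs <;> simp [h']

/-- The first component of the coupling is distributed as the original outcome. -/
theorem partitionEntropy_copy_fst (hp : ∀ ω, 0 ≤ p ω) (k u : Setoid Ω) :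
    partitionEntropy (copyWeight p k) (u.comap Prod.fst) = partitionEntropy p u := by
  classical
  have : ∀ z : Ω × Ω, classMass (copyWeight p k) (u.comap Prod.fst) z = classMass p u z.1 := by
    intro z
    unfold classMass
    rw [Fintype.sum_prod_type]
    refine Finset.sum_congr rfl fun x _ => ?_
    simp only [Setoid.comap_rel]
    split_ifs
    · exact sum_copyWeight_left hp k x
    · simp
  unfold partitionEntropy
  simp only [this]
  rw [sum_copyWeight_mul_fst hp k fun x => Real.log (classMass p u x)]

/-- The class in a partition coarser than `k` may be read off either component of the coupling, and
the second component is distributed as the original outcome. -/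
theorem partitionEntropy_copy_of_le (hp : ∀ ω, 0 ≤ p ω) {s : Setoid Ω} (hs : k ≤ s)
    (t : Setoid Ω) :
    partitionEntropy (copyWeight p k) (s.comap Prod.fst ⊓ t.comap Prod.snd) =
      partitionEntropy p (s ⊓ t) := by
  classical
  have key : ∀ z : Ω × Ω, k z.1 z.2 →
      classMass (copyWeight p k) (s.comap Prod.fst ⊓ t.comap Prod.snd) z =
        classMass p (s ⊓ t) z.2 := by
    intro z hz
    unfold classMass
    rw [Fintype.sum_prod_type_right]
    refine Finset.sum_congr rfl fun y _ => ?_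
    -- A pair of nonzero weight lies in one `k`-class, hence in one `s`-class. The condition on the
    -- first component thus moves to the second, leaving x free to be summed out.
    have : ∀ x, (if (s.comap Prod.fst ⊓ t.comap Prod.snd) z (x, y) then copyWeight p k (x, y)
        else 0) = if (s ⊓ t) z.2 y then copyWeight p k (x, y) else 0 := by
      intro x
      by_cases h0 : copyWeight p k (x, y) = 0
      · simp [h0]
      have hxy : s x y := hs (rel_of_copyWeight_ne_zero h0)
      have hiff : (s.comap Prod.fst ⊓ t.comap Prod.snd) z (x, y) ↔ (s ⊓ t) z.2 y := by
        change (s z.1 x ∧ t z.2 y) ↔ (s z.2 y ∧ t z.2 y)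
        refine and_congr_left fun _ => ⟨fun h => ?_, fun h => ?_⟩
        · exact s.trans (s.symm (hs hz)) (s.trans h hxy)
        · exact s.trans (hs hz) (s.trans h (s.symm hxy))
      by_cases h : (s ⊓ t) z.2 y
      · rw [if_pos h, if_pos (hiff.2 h)]
      · rw [if_neg h, if_neg fun h' => h (hiff.1 h')]
    rw [Finset.sum_congr rfl fun x _ => this x]
    split_ifs
    · exact sum_copyWeight_right hp k y
    · simp
  unfold partitionEntropy
  rw [← sum_copyWeight_mul_snd hp k fun x => Real.log (classMass p (s ⊓ t) x)]
  congr 1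
  refine Finset.sum_congr rfl fun z _ => ?_
  by_cases h0 : copyWeight p k z = 0
  · simp [h0]
  · rw [key z (rel_of_copyWeight_ne_zero h0)]

/-- The two components of the coupling are conditionally independent given the class in `k`. -/
theorem partitionEntropy_copy_of_ge (hp : ∀ ω, 0 ≤ p ω) {u : Setoid Ω} (hu : u ≤ k)
    (v : Setoid Ω) :
    partitionEntropy (copyWeight p k) (u.comap Prod.fst ⊓ v.comap Prod.snd) =
      partitionEntropy p u + partitionEntropy p (k ⊓ v) - partitionEntropy p k := by
  classical
  -- As `u` refines `k`, the class of the first component fixes the `k`-class; this cuts the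
  -- `v`-class down to a class of `k ⊓ v`, and the mass factors.
  have key : ∀ z : Ω × Ω, k z.1 z.2 →
      classMass (copyWeight p k) (u.comap Prod.fst ⊓ v.comap Prod.snd) z =
        classMass p u z.1 * classMass p (k ⊓ v) z.2 / classMass p k z.1 := by
    intro z hz
    unfold classMass
    rw [Fintype.sum_prod_type, Finset.sum_mul_sum, Finset.sum_div]
    refine Finset.sum_congr rfl fun x _ => ?_
    rw [Finset.sum_div]
    refine Finset.sum_congr rfl fun y _ => ?_
    by_cases hx : u z.1 x
    · have hzx : k z.1 x := hu hx
      by_cases hy : v z.2 y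
      · by_cases hxy : k x y
        · have h1 : (u.comap Prod.fst ⊓ v.comap Prod.snd) z (x, y) := ⟨hx, hy⟩
          have h2 : (k ⊓ v) z.2 y := ⟨k.trans (k.symm hz) (k.trans hzx hxy), hy⟩
          rw [if_pos h1, if_pos hx, if_pos h2]
          simp only [copyWeight, hxy, if_true]
          rw [← classMass_congr hzx]
          rfl
        · have h2 : ¬ (k ⊓ v) z.2 y := fun h =>
            hxy (k.trans (k.symm hzx) (k.trans hz h.1))
          rw [if_neg h2]
          simp [copyWeight, hxy]
      · have h1 : ¬ (u.comap Prod.fst ⊓ v.comap Prod.snd) z (x, y) := fun h => hy h.2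
        have h2 : ¬ (k ⊓ v) z.2 y := fun h => hy h.2
        rw [if_neg h1, if_neg h2]
        simp
    · have h1 : ¬ (u.comap Prod.fst ⊓ v.comap Prod.snd) z (x, y) := fun h => hx h.1
      rw [if_neg h1, if_neg hx]
      simp
  unfold partitionEntropy
  rw [← sum_copyWeight_mul_fst hp k fun x => Real.log (classMass p u x),
    ← sum_copyWeight_mul_snd hp k fun x => Real.log (classMass p (k ⊓ v) x),
    ← sum_copyWeight_mul_fst hp k fun x => Real.log (classMass p k x), ← neg_add, sub_neg_eq_add,
    neg_add_eq_sub, ← neg_sub, ← Finset.sum_add_distrib, ← Finset.sum_sub_distrib]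
  congr 1
  refine Finset.sum_congr rfl fun z _ => ?_
  by_cases h0 : copyWeight p k z = 0
  · simp [h0]
  · have h1 := classMass_pos hp u (left_ne_zero_of_copyWeight_ne_zero h0)
    have h2 := classMass_pos hp (k ⊓ v) (right_ne_zero_of_copyWeight_ne_zero h0)
    have h3 := classMass_pos hp k (left_ne_zero_of_copyWeight_ne_zero h0)
    rw [key z (rel_of_copyWeight_ne_zero h0), Real.log_div (mul_pos h1 h2).ne' h3.ne',
      Real.log_mul h1.ne' h2.ne']
    ring

end Copy

/-! ### Families of partitions, bit masks and the copy lemma -/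

/-- The common refinement of the partitions `X i` for the indices `i` in the set with bit mask
`m`. -/
def jointPartition {Ω : Type*} (X : ℕ → Setoid Ω) (m : ℕ) : Setoid Ω where
  r x y := ∀ i, m.testBit i → X i x y
  iseqv := ⟨fun x i _ => (X i).refl x, fun h i hi => (X i).symm (h i hi),
    fun h h' i hi => (X i).trans (h i hi) (h' i hi)⟩

/-- The first `n` partitions read on the first component of a pair, followed by all of them read on
the second component. -/
def copyFamily {Ω : Type*} (X : ℕ → Setoid Ω) (n i : ℕ) : Setoid (Ω × Ω) :=
  if i < n then (X i).comap Prod.fst else (X (i - n)).comap Prod.snd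

section Joint

variable {Ω : Type*} (X : ℕ → Setoid Ω)

theorem jointPartition_or (a b : ℕ) :
    jointPartition X (a ||| b) = jointPartition X a ⊓ jointPartition X b := by
  ext x y
  change (∀ i, (a ||| b).testBit i → X i x y) ↔
    (∀ i, a.testBit i → X i x y) ∧ (∀ i, b.testBit i → X i x y)
  simp only [Nat.testBit_or, Bool.or_eq_true, or_imp, forall_and]

theorem jointPartition_anti {a b : ℕ} (h : a ||| b = b) :
    jointPartition X b ≤ jointPartition X a := by
  rw [← h, jointPartition_or]
  exact inf_le_left

theorem jointPartition_zero : jointPartition X 0 = ⊤ := by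
  ext x y
  change (∀ i, (0 : ℕ).testBit i → X i x y) ↔ True
  simp

/-- The bound on `s` keeps its bits below the shifted bits of `t`, so each bit refers to a single
component. -/
theorem jointPartition_copyFamily {n s : ℕ} (hs : s < 2 ^ n) (t : ℕ) :
    jointPartition (copyFamily X n) (s ||| t <<< n) =
      (jointPartition X s).comap Prod.fst ⊓ (jointPartition X t).comap Prod.snd := by
  have hsn : ∀ i, s.testBit i → i < n := fun i hi => by
    by_contra hn
    rw [Nat.testBit_lt_two_pow (hs.trans_le (Nat.pow_le_pow_right two_pos (not_lt.1 hn)))] at hi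
    exact Bool.false_ne_true hi
  ext z w
  change (∀ i, (s ||| t <<< n).testBit i → copyFamily X n i z w) ↔
    (∀ i, s.testBit i → X i z.1 w.1) ∧ (∀ i, t.testBit i → X i z.2 w.2)
  simp only [Nat.testBit_or, Nat.testBit_shiftLeft, Bool.or_eq_true, Bool.and_eq_true,
    decide_eq_true_eq, or_imp, forall_and]
  refine and_congr (forall_congr' fun i => imp_congr_right fun hi => ?_)
    ⟨fun h i hi => ?_, fun h i hi => ?_⟩
  · rw [copyFamily, if_pos (hsn i hi)]
    rfl
  · have := h (i + n) ⟨Nat.le_add_left _ _, by simpa using hi⟩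
    rwa [copyFamily, if_neg (by omega), Nat.add_sub_cancel] at this
  · rw [copyFamily, if_neg (by omega)]
    exact h _ hi.2

end Joint

/-- Monotone submodular functions of finite sets of indices, given by bit masks. -/
structure IsPolymatroid (h : ℕ → ℝ) : Prop where
  mono : ∀ a b, a ||| b = b → h a ≤ h b
  submodular : ∀ a b, h (a ||| b) + h (a &&& b) ≤ h a + h b

/-- `h'` extends `h`, on subsets of `{0, …, n - 1}`, by copies `i + n` of the indices `i`.
The copies have the same joint values with the subsets of `b` as the originals, and are independent
of the originals conditionally on `b`. -/
structure IsCopy (n b : ℕ) (h h' : ℕ → ℝ) : Prop where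
  restrict : ∀ s < 2 ^ n, h' s = h s
  of_subset : ∀ s t, s ||| b = b → h' (s ||| t <<< n) = h (s ||| t)
  of_superset : ∀ s t, s < 2 ^ n → b ||| s = s → h' (s ||| t <<< n) = h s + h (b ||| t) - h b

section JointEntropy

variable {Ω : Type*} [Fintype Ω] {p : Ω → ℝ}

theorem isPolymatroid_jointPartition (hp : ∀ ω, 0 ≤ p ω) (X : ℕ → Setoid Ω) :
    IsPolymatroid fun m => partitionEntropy p (jointPartition X m) where
  mono a b hab := partitionEntropy_anti hp (jointPartition_anti X hab)
  submodular a b := by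
    rw [jointPartition_or]
    refine partitionEntropy_submodular hp (jointPartition_anti X ?_) (jointPartition_anti X ?_)
    · apply Nat.eq_of_testBit_eq
      intro i
      rw [Nat.testBit_or, Nat.testBit_and]
      cases a.testBit i <;> cases b.testBit i <;> rfl
    · apply Nat.eq_of_testBit_eq
      intro i
      rw [Nat.testBit_or, Nat.testBit_and]
      cases a.testBit i <;> cases b.testBit i <;> rfl

/-- The copy lemma. -/
theorem isCopy_copyFamily (hp : ∀ ω, 0 ≤ p ω) (X : ℕ → Setoid Ω) {n b : ℕ} (hb : b < 2 ^ n) :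
    IsCopy n b (fun m => partitionEntropy p (jointPartition X m)) fun m =>
      partitionEntropy (copyWeight p (jointPartition X b)) (jointPartition (copyFamily X n) m) where
  restrict s hs := by
    have := jointPartition_copyFamily X hs 0
    have htop : (⊤ : Setoid Ω).comap (Prod.snd : Ω × Ω → Ω) = ⊤ := rfl
    rw [Nat.zero_shiftLeft, Nat.or_zero, jointPartition_zero, htop, inf_top_eq] at this
    rw [this, partitionEntropy_copy_fst hp]
  of_subset s t hs := by
    have hsn : s < 2 ^ n := (hs ▸ Nat.left_le_or).trans_lt hb
    rw [jointPartition_copyFamily X hsn,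
      partitionEntropy_copy_of_le hp (jointPartition_anti X hs), jointPartition_or]
  of_superset s t hsn hs := by
    rw [jointPartition_copyFamily X hsn,
      partitionEntropy_copy_of_ge hp (jointPartition_anti X hs), jointPartition_or]

/-- Total mass one enters here; the Shannon inequalities and the copy lemma need only nonnegative
weights. -/
theorem partitionEntropy_jointPartition_zero (hp : ∑ ω, p ω = 1) (X : ℕ → Setoid Ω) :
    partitionEntropy p (jointPartition X 0) = 0 := by
  have : ∀ ω, classMass p (⊤ : Setoid Ω) ω = 1 := fun ω => by
    rw [← hp]
    exact Finset.sum_congr rfl fun x _ => if_pos trivial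
  simp [jointPartition_zero, partitionEntropy, this]

end JointEntropy

/-! ### Polymatroid inequalities and the linear programming certificate -/

namespace IsPolymatroid

variable {h : ℕ → ℝ}

/-- If `e` is determined by `v`, then it is determined by every set that includes `v`. -/
theorem determined (H : IsPolymatroid h) {e v : ℕ} (hv : h (v ||| e) = h v) (m m' : ℕ)
    (hm : v ||| m = m := by decide) (hm' : m ||| e = m' := by decide) : h m' = h m := by
  subst hm'
  refine le_antisymm ?_ (H.mono _ _ ?_)
  · have h1 := H.submodular (v ||| e) m
    have h2 : v ||| e ||| m = m ||| e := by rw [Nat.lor_assoc, Nat.lor_comm e, ← Nat.lor_assoc, hm]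
    have h3 := H.mono v ((v ||| e) &&& m) (by
      rw [← hm]
      apply Nat.eq_of_testBit_eq
      intro i
      simp only [Nat.testBit_or, Nat.testBit_and]
      cases v.testBit i <;> cases e.testBit i <;> cases m.testBit i <;> rfl)
    rw [h2] at h1
    linarith
  · rw [← Nat.lor_assoc, Nat.or_self]

/-- Union and intersection are separate arguments, checked by `decide`, so that values of `h` appear
at literal masks and match as atoms in a linear combination. -/
theorem union_add_inter_le (H : IsPolymatroid h) (a b u v : ℕ) (hu : a ||| b = u := by decide)
    (hv : a &&& b = v := by decide) : h u + h v ≤ h a + h b :=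
  hu ▸ hv ▸ H.submodular a b

theorem le_of_subset (H : IsPolymatroid h) (a b : ℕ) (hab : a ||| b = b := by decide) :
    h a ≤ h b :=
  H.mono a b hab

end IsPolymatroid

/-- Let `h₀` be the entropy function of a secret `0` and shares `1, …, 7`. Copy `0, 1` over
`2, 3, 4, 5`, to `8, 9`, and then `0, 2, 3` over `4, …, 9`, to `16, 18, 19`. Shannon inequalities
for the result `h` bound the size of the shares in every scheme with the qualified sets `123`,
`145`, `1367`, `1467`, `1567`, `3456`, `3467`, `3567` and the unqualified sets `1`, `167`, `2345`, `2367`,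
`4567`. A set of indices is given by its bit mask, so that `14` stands for `{1, 2, 3}`. -/
theorem eight_mul_secret_le {h₀ h₁ h : ℕ → ℝ} (H : IsPolymatroid h) (H₁ : IsCopy 8 60 h₀ h₁)
    (H₂ : IsCopy 16 1008 h₁ h) (h_empty : h₀ 0 = 0)
    (hqual : ∀ v ∈ [14, 50, 202, 210, 226, 120, 216, 232], h₀ (v ||| 1) = h₀ v)
    (hunqual : ∀ v ∈ [2, 194, 60, 204, 240], h₀ (v ||| 1) = h₀ v + h₀ 1)
    {ρ : ℝ} (hshare : ∀ v ∈ [2, 4, 8, 16, 32], h₀ v ≤ ρ) :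
    8 * h₀ 1 ≤ 7 * ρ := by
  -- All facts about `h₀` and `h₁` are transported to the single function `h`.
  have e₁ : ∀ s < 2 ^ 16, h₁ s = h s := fun s hs => (H₂.restrict s hs).symm
  have e₀ : ∀ s < 2 ^ 8, h₀ s = h s := fun s hs => by
    rw [← H₁.restrict s hs, e₁ s (hs.trans (by decide))]
  have c₁ : ∀ s t m m', s ||| 60 = 60 ∧ s ||| t <<< 8 = m ∧ s ||| t = m' ∧ m < 2 ^ 16 ∧
      m' < 2 ^ 8 → h m = h m' := by
    rintro s t _ _ ⟨hs, rfl, rfl, hm, hm'⟩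
    rw [← e₁ _ hm, ← e₀ _ hm', H₁.of_subset s t hs]
  have i₁ : ∀ s t m m', 60 ||| s = s ∧ s ||| t <<< 8 = m ∧ 60 ||| t = m' ∧ s < 2 ^ 8 ∧
      m < 2 ^ 16 ∧ m' < 2 ^ 8 → h m = h s + h m' - h 60 := by
    rintro s t _ _ ⟨hs, rfl, rfl, hs', hm, hm'⟩
    rw [← e₁ _ hm, ← e₀ _ hm', ← e₀ _ hs', ← e₀ 60 (by decide), H₁.of_superset s t hs' hs]
  have c₂ : ∀ s t m m', s ||| 1008 = 1008 ∧ s ||| t <<< 16 = m ∧ s ||| t = m' ∧ m' < 2 ^ 16 →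
      h m = h m' := by
    rintro s t _ _ ⟨hs, rfl, rfl, hm'⟩
    rw [← e₁ _ hm', H₂.of_subset s t hs]
  have qual : ∀ v ∈ [14, 50, 202, 210, 226, 120, 216, 232], v < 2 ^ 8 ∧ v ||| 1 < 2 ^ 8 →
      h (v ||| 1) = h v := by
    rintro v hv ⟨h1, h2⟩
    rw [← e₀ _ h1, ← e₀ _ h2, hqual v hv]
  have hu : ∀ v m, v ∈ [2, 194, 60, 204, 240] ∧ v ||| 1 = m ∧ v < 2 ^ 8 ∧ m < 2 ^ 8 →
      h m = h v + h 1 := by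
    rintro v _ ⟨hv, rfl, h1, h2⟩
    rw [← e₀ _ h1, ← e₀ _ h2, ← e₀ 1 (by decide), hunqual v hv]
  have q123 : h (14 ||| 1) = h 14 := qual _ (by decide) (by decide)
  have q145 : h (50 ||| 1) = h 50 := qual _ (by decide) (by decide)
  have q1567 : h (226 ||| 1) = h 226 := qual _ (by decide) (by decide)
  have q1467 : h (210 ||| 1) = h 210 := qual _ (by decide) (by decide)
  have q1367 : h (202 ||| 1) = h 202 := qual _ (by decide) (by decide)
  have q3456 : h (120 ||| 1) = h 120 := qual _ (by decide) (by decide)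
  have q3467 : h (216 ||| 1) = h 216 := qual _ (by decide) (by decide)
  have q3567 : h (232 ||| 1) = h 232 := qual _ (by decide) (by decide)
  -- The copies 8, 9 of 0, 1 have the original joint law with 2, 3, 4, 5, so 9 takes the place of 1
  -- in the qualified sets 123 and 145.
  have q239 : h (524 ||| 256) = h 524 :=
    (c₁ 12 3 _ _ (by decide)).trans (q123.trans (c₁ 12 2 _ _ (by decide)).symm)
  have q459 : h (560 ||| 256) = h 560 :=
    (c₁ 48 3 _ _ (by decide)).trans (q145.trans (c₁ 48 2 _ _ (by decide)).symm)
  -- Likewise 19, the second-step copy of 3, recovers the copied secret 16 from 4, 6, 7 or from 5,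
  -- 6, 7.
  have qCopy467 : h (524496 ||| 65536) = h 524496 :=
    (c₂ 208 9 _ _ (by decide)).trans (q3467.trans (c₂ 208 8 _ _ (by decide)).symm)
  have qCopy567 : h (524512 ||| 65536) = h 524512 :=
    (c₂ 224 9 _ _ (by decide)).trans (q3567.trans (c₂ 224 8 _ _ (by decide)).symm)
  -- The second copy is over 4, …, 9, but 4, 5, 9 determine 8. Hence index 8 (mask 256) can be
  -- dropped, and independence holds given 4, 5, 6, 7, 9 (mask 752).
  have i₂ : ∀ s t m m', (1008 ||| (s ||| 256) = s ||| 256 ∧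
      s ||| 256 ||| t <<< 16 = m ||| 256 ∧ 1008 ||| t = m' ||| 256) ∧
      (560 ||| s = s ∧ 560 ||| m = m ∧ 560 ||| m' = m') ∧
      s ||| 256 < 2 ^ 16 ∧ m' ||| 256 < 2 ^ 16 → h m = h s + h m' - h 752 := by
    rintro s t m m' ⟨⟨hs, hm, hm'⟩, ⟨h1, h2, h3⟩, hs', ht'⟩
    have key := H₂.of_superset (s ||| 256) t hs' hs
    rwa [hm, hm', e₁ _ hs', e₁ _ ht', e₁ 1008 (by decide), H.determined q459 m _ h2 rfl,
      H.determined q459 s _ h1 rfl, H.determined q459 m' _ h3 rfl,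
      H.determined q459 752 1008] at key
  have hρ : ∀ v, v ∈ [2, 4, 8, 16, 32] ∧ v < 2 ^ 8 → h v ≤ ρ := fun v hv => by
    rw [← e₀ _ hv.2]
    exact hshare v hv.1
  rw [e₀ 0 (by decide)] at h_empty
  rw [e₀ 1 (by decide)]
  -- A dual certificate: inequalities carry nonnegative weights, equations weights of either sign.
  -- The share bounds have total weight 42 and the privacy equations `hu` total weight -48; the
  -- factor 1/6 turns these into 7 and 8.
  linear_combination
    (1 / 6) * (
      28 * hρ 2 (by decide)
      + 2 * hρ 4 (by decide)
      + 4 * hρ 8 (by decide)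
      + 4 * hρ 16 (by decide)
      + 4 * hρ 32 (by decide)
      + 16 * H.le_of_subset 61 63
      + 2 * H.le_of_subset 497 499
      + 2 * H.le_of_subset 969 971
      + 2 * H.le_of_subset 852161 852163
      + 2 * H.le_of_subset 497 505
      + 2 * H.le_of_subset 461 973
      + 2 * H.le_of_subset 498 1010
      + 2 * H.le_of_subset 504 1016
      + 2 * H.le_of_subset 241 253
      + 4 * H.le_of_subset 205 253
      + 2 * H.union_add_inter_le 969 972 973 968
      + 4 * H.union_add_inter_le 771 962 963 770
      + 2 * H.union_add_inter_le 786433 786624 786625 786432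
      + 2 * H.union_add_inter_le 852161 852208 852209 852160
      + 2 * H.union_add_inter_le 2 8 10 0
      + 2 * H.union_add_inter_le 194 208 210 192
      + 2 * H.union_add_inter_le 2 32 34 0
      + 10 * H.union_add_inter_le 2 512 514 0
      + 2 * H.union_add_inter_le 770 525056 525058 768
      + 2 * H.union_add_inter_le 770 960 962 768
      + 2 * H.union_add_inter_le 525058 525248 525250 525056
      + 2 * H.union_add_inter_le 786435 786625 786627 786433
      + 8 * H.union_add_inter_le 2 12 14 0
      + 4 * H.union_add_inter_le 514 524 526 512
      + 2 * H.union_add_inter_le 786946 786956 786958 786944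
      + 2 * H.union_add_inter_le 2 48 50 0
      + 4 * H.union_add_inter_le 514 560 562 512
      + 2 * H.union_add_inter_le 786434 786480 786482 786432
      + 4 * H.union_add_inter_le 2 786432 786434 0
      + 2 * H.union_add_inter_le 4 8 12 0
      + 2 * H.union_add_inter_le 10 194 202 2
      + 2 * H.union_add_inter_le 203 963 971 195
      + 2 * H.union_add_inter_le 16 32 48 0
      + H.union_add_inter_le 590035 590051 590067 590019
      + H.union_add_inter_le 590803 590819 590835 590787
      + H.union_add_inter_le 211 524483 524499 195
      + H.union_add_inter_le 978 525250 525266 962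
      + 2 * H.union_add_inter_le 16 192 208 0
      + H.union_add_inter_le 211 963 979 195
      + H.union_add_inter_le 227 524483 524515 195
      + H.union_add_inter_le 994 525250 525282 962
      + 2 * H.union_add_inter_le 34 194 226 2
      + H.union_add_inter_le 227 963 995 195
      + 4 * H.union_add_inter_le 497 253 509 241
      + 2 * H.union_add_inter_le 461 253 509 205
      + 8 * H.union_add_inter_le 512 192 704 0
      + 6 * H.union_add_inter_le 524 204 716 12
      + 8 * H.union_add_inter_le 704 240 752 192
      + 2 * H.union_add_inter_le 786947 786483 786995 786435
      + 2 * H.union_add_inter_le 514 786434 786946 2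
      + 2 * H.union_add_inter_le 753 786673 787185 241
      + 2 * H.union_add_inter_le 590019 786627 852163 524483
      + 2 * H.union_add_inter_le 787148 787004 787196 786956
      + 2 * H.union_add_inter_le 766 787006 787198 574
      + 4 * H.union_add_inter_le 783 819 831 771
      + 2 * H.union_add_inter_le 786959 786995 787007 786947
      + 2 * H.union_add_inter_le 572 786992 787004 560
      + 2 * H.union_add_inter_le 972 787392 787404 960
      + H.union_add_inter_le 590067 590787 590835 590019
      - 2 * i₂ 766 12 787198 764 (by decide)
      - 2 * H.determined q145 590834 590835
      - 2 * i₂ 764 12 787196 764 (by decide)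
      - 2 * H.determined q123 787006 787007
      - 2 * H.determined q459 590578 590834
      + H.determined q1567 590818 590819
      + H.determined q1467 590802 590803
      - 2 * H.determined qCopy467 786673 852209
      - 2 * H.determined q239 787148 787404
      - 2 * i₂ 753 12 787185 764 (by decide)
      + H.determined qCopy567 525282 590818
      + H.determined qCopy467 525266 590802
      - 2 * H.determined qCopy467 525042 590578
      - 4 * H.determined q123 830 831
      - 6 * H.determined q3456 508 509
      + 2 * H.determined qCopy467 786672 852208
      + 2 * H.determined q123 786958 786959
      + H.determined q1567 590050 590051
      + H.determined q1467 590034 590035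
      - 2 * i₂ 754 8 525042 760 (by decide)
      + 2 * H.determined q459 760 1016
      + 2 * H.determined q459 754 1010
      - H.determined q1567 994 995
      - H.determined q1467 978 979
      - 4 * H.determined q239 574 830
      - 8 * i₁ 252 2 764 62 (by decide)
      - 6 * i₁ 252 1 508 61 (by decide)
      + 2 * H.determined q3456 504 505
      + 2 * H.determined q145 498 499
      + 12 * H.determined q3456 252 253
      + 2 * c₂ 960 12 787392 972 (by decide)
      + 2 * c₂ 240 12 786672 252 (by decide)
      + 2 * H.determined q145 786482 786483
      + H.determined qCopy567 524514 590050
      + H.determined qCopy467 524498 590034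
      - H.determined q1567 524514 524515
      - H.determined q1467 524498 524499
      + 6 * H.determined q239 716 972
      + 4 * H.determined q145 818 819
      + 4 * H.determined q123 782 783
      - 6 * i₁ 62 2 574 62 (by decide)
      + 16 * H.determined q123 62 63
      - 2 * c₂ 192 13 852160 205 (by decide)
      + 2 * c₂ 560 12 786992 572 (by decide)
      + 2 * c₂ 960 8 525248 968 (by decide)
      + 4 * H.determined q459 562 818
      + 4 * H.determined q239 526 782
      + 4 * c₁ 60 2 572 62 (by decide)
      - 8 * hu 240 241 (by decide)
      + 2 * H.determined q1567 226 227
      + 2 * H.determined q1467 210 211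
      - 8 * hu 204 205 (by decide)
      + 2 * H.determined q1367 202 203
      - 22 * hu 60 61 (by decide)
      + 2 * c₂ 192 12 786624 204 (by decide)
      + 2 * c₂ 48 12 786480 60 (by decide)
      - 6 * hu 194 195 (by decide)
      - 2 * c₂ 512 12 786944 524 (by decide)
      + 2 * c₁ 48 2 560 50 (by decide)
      + 8 * c₁ 12 2 524 14 (by decide)
      - 4 * c₁ 0 3 768 3 (by decide)
      - 4 * hu 2 3 (by decide)
      + 10 * c₁ 0 2 512 2 (by decide)
      - 42 * h_empty)

/-! ### From random variables to partitions of their joint values -/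

section Bridge

variable {Ω : Type*} [MeasurableSpace Ω] (μ : Measure Ω)

/-- The entropy of a function of a finite-valued random variable `Y` is that of the partition which
the function induces on the values of `Y`. -/
theorem entropy_comp_eq_partitionEntropy [IsFiniteMeasure μ] {A β : Type*} [Fintype A]
    [MeasurableSpace A] [MeasurableSingletonClass A] [Fintype β] {Y : Ω → A} (hY : Measurable Y)
    (f : A → β) :
    SecretSharing.entropy μ (fun ω => f (Y ω)) =
      partitionEntropy (fun a => μ.real (Y ⁻¹' {a})) (Setoid.ker f) := by
  classical
  have hmass : ∀ b, μ.real ((fun ω => f (Y ω)) ⁻¹' {b}) =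
      ∑ a with f a = b, μ.real (Y ⁻¹' {a}) := by
    intro b
    have hpre : (fun ω => f (Y ω)) ⁻¹' {b} =
        ⋃ a ∈ Finset.univ.filter fun a => f a = b, Y ⁻¹' {a} := by
      ext ω
      simp
    rw [hpre, measureReal_biUnion_finset]
    · intro a _ a' _ haa'
      exact Disjoint.preimage _ (by simpa using haa')
    · exact fun a _ => hY (measurableSet_singleton a)
  unfold SecretSharing.entropy partitionEntropy
  rw [← Finset.sum_fiberwise (s := Finset.univ) (g := f), ← Finset.sum_neg_distrib]
  refine Finset.sum_congr rfl fun b _ => ?_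
  rw [hmass, Real.negMulLog, neg_mul, Finset.sum_mul]
  congr 1
  refine Finset.sum_congr rfl fun a ha => ?_
  have hab : f a = b := (Finset.mem_filter.1 ha).2
  have : classMass (fun a => μ.real (Y ⁻¹' {a})) (Setoid.ker f) a =
      ∑ a with f a = b, μ.real (Y ⁻¹' {a}) := by
    rw [Finset.sum_filter]
    refine Finset.sum_congr rfl fun x _ => ?_
    have hiff : Setoid.ker f a x ↔ f x = b := by
      rw [Setoid.ker_def, hab, eq_comm]
    by_cases hx : f x = b
    · rw [if_pos hx, if_pos (hiff.2 hx)]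
    · rw [if_neg hx, if_neg fun h' => hx (hiff.1 h')]
  rw [this]

end Bridge

/-- The partitions of the value space of a family by its members, indexed by natural numbers. -/
def coordinatePartition {n : ℕ} (α : Fin n → Type*) (i : ℕ) : Setoid (∀ i, α i) :=
  -- Indices beyond the family get the one-class partition and carry no information.
  if hi : i < n then Setoid.ker fun x => x ⟨i, hi⟩ else ⊤

theorem jointPartition_coordinatePartition {n : ℕ} (α : Fin n → Type*) (V : Finset (Fin n)) (m : ℕ)
    (hV : ∀ i : Fin n, i ∈ V ↔ m.testBit i) :
    jointPartition (coordinatePartition α) m =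
      Setoid.ker fun (x : ∀ i, α i) (i : V) => x i := by
  ext x y
  change (∀ i, m.testBit i → coordinatePartition α i x y) ↔
    (fun i : V => x i) = fun i : V => y i
  rw [funext_iff]
  constructor
  · rintro h ⟨i, hi⟩
    have := h i ((hV i).1 hi)
    rwa [coordinatePartition, dif_pos i.2] at this
  · intro h i hi
    by_cases hin : i < n
    · rw [coordinatePartition, dif_pos hin]
      exact h ⟨⟨i, hin⟩, (hV _).2 hi⟩
    · rw [coordinatePartition, dif_neg hin]
      trivial

section Main

variable {Ω : Type*} [MeasurableSpace Ω] (μ : Measure Ω) [IsProbabilityMeasure μ] {n : ℕ}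
  {α : Fin n → Type*} [∀ i, Fintype (α i)] [∀ i, MeasurableSpace (α i)]
  [∀ i, MeasurableSingletonClass (α i)] {S : (i : Fin n) → Ω → α i}

theorem entropy_tuple_eq (hS : ∀ i, Measurable (S i)) (V : Finset (Fin n)) (m : ℕ)
    (hV : ∀ i : Fin n, i ∈ V ↔ m.testBit i) :
    SecretSharing.entropy μ (SecretSharing.tuple S V) =
      partitionEntropy (fun x : ∀ i, α i => μ.real ((fun ω i => S i ω) ⁻¹' {x}))
        (jointPartition (coordinatePartition α) m) := by
  rw [jointPartition_coordinatePartition α V m hV]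
  exact entropy_comp_eq_partitionEntropy μ (measurable_pi_lambda _ hS)
    fun (x : ∀ i, α i) (i : V) => x i

theorem entropy_eq (hS : ∀ i, Measurable (S i)) (i : Fin n) :
    SecretSharing.entropy μ (S i) =
      partitionEntropy (fun x : ∀ i, α i => μ.real ((fun ω i => S i ω) ⁻¹' {x}))
        (jointPartition (coordinatePartition α) (2 ^ (i : ℕ))) := by
  rw [jointPartition_coordinatePartition α {i} (2 ^ (i : ℕ)) fun j => by
    rw [Nat.testBit_two_pow, Finset.mem_singleton, Fin.ext_iff, decide_eq_true_eq, eq_comm]]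
  have hker : (Setoid.ker fun (x : ∀ i, α i) (j : ({i} : Finset (Fin n))) => x j) =
      Setoid.ker fun x : ∀ i, α i => x i := by
    ext x y
    rw [Setoid.ker_def, Setoid.ker_def, funext_iff]
    exact ⟨fun h => h ⟨i, Finset.mem_singleton_self i⟩, fun h ⟨j, hj⟩ => by
      obtain rfl := Finset.mem_singleton.1 hj
      exact h⟩
  rw [hker]
  exact entropy_comp_eq_partitionEntropy μ (measurable_pi_lambda _ hS) fun x => x i

theorem sum_measureReal_preimage_singleton {A : Type*} [Fintype A] [MeasurableSpace A]
    [MeasurableSingletonClass A] {Y : Ω → A} (hY : Measurable Y) :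
    ∑ a, μ.real (Y ⁻¹' {a}) = 1 := by
  rw [← measureReal_biUnion_finset (fun a _ a' _ haa' => Disjoint.preimage _ (by simpa using haa'))
    fun a _ => hY (measurableSet_singleton a)]
  have : (⋃ a ∈ Finset.univ, Y ⁻¹' {a}) = Set.univ := by
    ext ω
    simp
  rw [this, probReal_univ]

end Main

/-! ### Application to the Vámos port -/

/-- Every perfect secret sharing scheme for this access structure has information ratio at least
`8 / 7`. -/
theorem eight_mul_entropy_secret_le {Ω : Type*} [MeasurableSpace Ω] (μ : Measure Ω)
    [IsProbabilityMeasure μ] {α : Fin 8 → Type*} [∀ i, Fintype (α i)] [∀ i, MeasurableSpace (α i)]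
    [∀ i, MeasurableSingletonClass (α i)] (S : (i : Fin 8) → Ω → α i)
    (hS : ∀ i, Measurable (S i))
    (hperfect : SecretSharing.IsPerfectScheme μ S SecretSharing.vamosMinimalQualified)
    {ρ : ℝ} (hρ : ∀ i : Fin 7, SecretSharing.entropy μ (S i.succ) ≤ ρ) :
    8 * SecretSharing.entropy μ (S 0) ≤ 7 * ρ := by
  -- Passing to the joint law replaces the arbitrary probability space by a finite one, where the
  -- coupling is defined.
  set p : (∀ i, α i) → ℝ := fun x => μ.real ((fun ω i => S i ω) ⁻¹' {x}) with hp_def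
  have hp : ∀ x, 0 ≤ p x := fun x => measureReal_nonneg
  set X := coordinatePartition α with hX
  have htuple : ∀ (V : Finset (Fin 8)) (m : ℕ), (∀ i : Fin 8, i ∈ V ↔ m.testBit i) →
      SecretSharing.entropy μ (SecretSharing.tuple S V) =
        partitionEntropy p (jointPartition X m) := entropy_tuple_eq μ hS
  have hone : ∀ i : Fin 8, SecretSharing.entropy μ (S i) =
      partitionEntropy p (jointPartition X (2 ^ (i : ℕ))) := entropy_eq μ hS
  have hqual : ∀ (V : Finset (Fin 8)) (m : ℕ), (∀ i : Fin 8, i ∈ V ↔ m.testBit i) →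
      (∀ i : Fin 8, i ∈ {0} ∪ V ↔ (m ||| 1).testBit i) → V ∈ SecretSharing.vamosMinimalQualified →
      partitionEntropy p (jointPartition X (m ||| 1)) =
        partitionEntropy p (jointPartition X m) := by
    intro V m hm hm' hV
    have := hperfect.correct V hV
    rw [SecretSharing.condEntropy, htuple _ _ hm, htuple _ _ hm'] at this
    linarith
  have hunqual : ∀ (V : Finset (Fin 8)) (m : ℕ), (∀ i : Fin 8, i ∈ V ↔ m.testBit i) →
      (∀ i : Fin 8, i ∈ {0} ∪ V ↔ (m ||| 1).testBit i) → 0 ∉ V →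
      (∀ Q ∈ SecretSharing.vamosMinimalQualified, ¬ Q ⊆ V) →
      partitionEntropy p (jointPartition X (m ||| 1)) =
        partitionEntropy p (jointPartition X m) + partitionEntropy p (jointPartition X 1) := by
    intro V m hm hm' h0 hV
    have := hperfect.priv V h0 hV
    rw [SecretSharing.condEntropy, htuple _ _ hm, htuple _ _ hm', hone 0] at this
    change _ = partitionEntropy p (jointPartition X 1) at this
    linarith
  have hcopy := copyWeight_nonneg hp (jointPartition X 60)
  have main := eight_mul_secret_le (ρ := ρ)
    (isPolymatroid_jointPartition (copyWeight_nonneg hcopy _) _)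
    (isCopy_copyFamily hp X (n := 8) (b := 60) (by decide))
    (isCopy_copyFamily hcopy (copyFamily X 8) (n := 16) (b := 1008) (by decide))
    (partitionEntropy_jointPartition_zero
      (sum_measureReal_preimage_singleton μ (measurable_pi_lambda _ hS)) X)
  rw [hone 0]
  refine main ?_ ?_ ?_
  · simp only [List.forall_mem_cons, List.not_mem_nil, false_imp_iff, implies_true, and_true]
    refine ⟨hqual {1, 2, 3} _ ?_ ?_ ?_, hqual {1, 4, 5} _ ?_ ?_ ?_, hqual {1, 3, 6, 7} _ ?_ ?_ ?_,
      hqual {1, 4, 6, 7} _ ?_ ?_ ?_, hqual {1, 5, 6, 7} _ ?_ ?_ ?_, hqual {3, 4, 5, 6} _ ?_ ?_ ?_,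
      hqual {3, 4, 6, 7} _ ?_ ?_ ?_, hqual {3, 5, 6, 7} _ ?_ ?_ ?_⟩ <;>
    first
    | decide
    | (unfold SecretSharing.vamosMinimalQualified; rw [Set.mem_ofPred_eq]; decide)
  -- A four-element minimal qualified set inside a set of at most four elements equals it, so only
  -- the three exceptional four-sets need naming.
  · have hsmall : ∀ V : Finset (Fin 8), V.card ≤ 4 → ¬ {1, 2, 3} ⊆ V → ¬ {1, 4, 5} ⊆ V →
        (V.card = 4 → V = {2, 3, 4, 5} ∨ V = {2, 3, 6, 7} ∨ V = {4, 5, 6, 7}) →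
        ∀ Q ∈ SecretSharing.vamosMinimalQualified, ¬ Q ⊆ V := by
      rintro V hV h1 h2 h3 Q (rfl | rfl | ⟨-, hc, -, -, h4, h5, h6⟩) hQ
      · exact h1 hQ
      · exact h2 hQ
      · obtain rfl := Finset.eq_of_subset_of_card_le hQ (by omega)
        rcases h3 hc with h | h | h
        · exact h4 h
        · exact h5 h
        · exact h6 h
    simp only [List.forall_mem_cons, List.not_mem_nil, false_imp_iff, implies_true, and_true]
    refine ⟨hunqual {1} _ ?_ ?_ ?_ (hsmall _ ?_ ?_ ?_ ?_),
      hunqual {1, 6, 7} _ ?_ ?_ ?_ (hsmall _ ?_ ?_ ?_ ?_),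
      hunqual {2, 3, 4, 5} _ ?_ ?_ ?_ (hsmall _ ?_ ?_ ?_ ?_),
      hunqual {2, 3, 6, 7} _ ?_ ?_ ?_ (hsmall _ ?_ ?_ ?_ ?_),
      hunqual {4, 5, 6, 7} _ ?_ ?_ ?_ (hsmall _ ?_ ?_ ?_ ?_)⟩ <;> decide
  · simp only [List.forall_mem_cons, List.not_mem_nil, false_imp_iff, implies_true, and_true]
    exact ⟨hone 1 ▸ hρ 0, hone 2 ▸ hρ 1, hone 3 ▸ hρ 2, hone 4 ▸ hρ 3, hone 5 ▸ hρ 4⟩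

theorem mainTheorem1 {Ω : Type*} [MeasurableSpace Ω] (μ : Measure Ω) [IsProbabilityMeasure μ]
    {α : Fin 8 → Type*} [∀ i, Fintype (α i)] [∀ i, MeasurableSpace (α i)]
    [∀ i, MeasurableSingletonClass (α i)] (S : (i : Fin 8) → Ω → α i)
    (hS : ∀ i, Measurable (S i))
    (hperfect : SecretSharing.IsPerfectScheme μ S SecretSharing.vamosMinimalQualified)
    (hsecret : 0 < SecretSharing.entropy μ (S 0)) :
    (561 / 491 : ℝ) ≤ SecretSharing.informationRatio μ S := by
  rw [SecretSharing.informationRatio, le_div_iff₀ hsecret]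
  have := eight_mul_entropy_secret_le μ S hS hperfect
    (ρ := Finset.univ.sup' Finset.univ_nonempty fun i : Fin 7 => SecretSharing.entropy μ (S i.succ))
    fun i => Finset.le_sup' (fun i : Fin 7 => SecretSharing.entropy μ (S i.succ))
      (Finset.mem_univ i)
  -- 8/7 exceeds 561/491 because 8 · 491 = 3928 and 7 · 561 = 3927.
  linarith
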